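/- Let $R$ be a commutative Noetherian ring of finite Krull dimension and let $M$ be a nonzero finitely generated $R$-module. Define the length $\operatorname{len}(M)$ of $M$ to be the supremum of all ordinals $\alpha$ for which there is a strictly descending chain of nonzero submodules of $M$ of order type $\alpha$ (i.e. a chain of nonzero submodules which, ordered by inverse inclusion, is isomorphic to $\alpha$). Call $M$ univalent if $\operatorname{len}(M)=\omega^d$ for some natural number $d\geq 0$, and compressible if for each nonzero submodule $N\subseteq M$ there is an injective $R$-linear map $M\to N$. Then $M$ is compressible if and only if it is univalent. -/

import Mathlib

namespace OrdinalLength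

universe u v

variable (R : Type u) [CommRing R] (M : Type v) [AddCommGroup M] [Module R M]

/-- `HasChain R M α` : there is a strictly descending chain of nonzero submodules of `M` of order
type `α`, i.e. the nonzero submodules of `M`, ordered by inverse inclusion, contain a
chain isomorphic to the ordinal `α`. -/
def HasChain (α : Ordinal.{v}) : Prop :=
  ∃ f : Set.Iio α → Submodule R M, StrictAnti f ∧ ∀ i, f i ≠ ⊥

/-- The (ordinal) length of `M`: the supremum of all ordinals arising as chains of submodules of `M`
under inverse inclusion. The zero submodule, the last member of any complete chain, is not
counted, so that a chain `M = M₀ > M₁ > ⋯ > Mₙ = 0` contributes `n`, as for the usual length. -/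
noncomputable def len : Ordinal.{v} :=
  sSup {α : Ordinal.{v} | HasChain R M α}

/-- The supremum defining the length is one of a bounded set of ordinals. -/
theorem bddAbove_hasChain : BddAbove {α : Ordinal.{v} | HasChain R M α} := by
  refine ⟨(Order.succ (Cardinal.mk (Submodule R M))).ord, ?_⟩
  rintro α ⟨f, hf, -⟩
  have h := Cardinal.mk_le_of_injective
    (hf.injective.comp (Ordinal.ToType.mk (o := α)).symm.injective)
  rw [Cardinal.mk_toType] at h
  exact (Cardinal.lt_ord.2 (Order.lt_succ_of_le h)).le

/-- A module is univalent if its length is `ω ^ d` for some natural number `d`. -/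
def IsUnivalent : Prop :=
  ∃ d : ℕ, len R M = Ordinal.omega0 ^ (d : Ordinal.{v})

/-- A module is compressible if it admits a monomorphism into each of its nonzero submodules. -/
def IsCompressible : Prop :=
  ∀ N : Submodule R M, N ≠ ⊥ → ∃ f : M →ₗ[R] N, Function.Injective f

end OrdinalLength

/-! Lengths below `ω ^ d` are closed under extensions (`len_lt_of_exact`): a submodule in a chain is
measured by its traces on sub and quotient, and natural sums stay below `ω ^ d`.

For a prime `p`, `R ⧸ p` is compressible, so its length is additively indecomposable, hence a power
of `ω`; induction on the coheight of `p` makes the exponent finite. A compressible module embeds in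
any copy of some `R ⧸ p` that it contains, so it shares that length.

Conversely, let `M` have length `ω ^ d`. A chain of type `ω ^ d` in a quotient by `N ≠ ⊥` could be
prolonged by `N`; since such chains exist once the length reaches `ω ^ d`
(`len_lt_of_not_hasChain`), proper quotients are shorter, and by extension nonzero submodules are
not. If `N ≅ R ⧸ p` lies in `M`, then some `s ∉ p` kills the shorter module `M ⧸ N`, and
multiplication by `s` embeds `M` in the compressible module `N`. -/

namespace OrdinalLength

open Ordinal

universe u v

/-! ### Natural sums of ordinals below `ω ^ k` -/

/-- The natural (Hessenberg) sum of two ordinals below `ω ^ k`, computed on Cantor normal forms. -/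
noncomputable def natSum : ℕ → Ordinal.{v} → Ordinal.{v} → Ordinal.{v}
  | 0, _, _ => 0
  | k + 1, x, y => ω ^ k * (x / ω ^ k + y / ω ^ k) + natSum k (x % ω ^ k) (y % ω ^ k)

/-- Leading Cantor coefficients are natural numbers, so adding them is commutative and strictly
monotone on both sides, which ordinal addition is not. -/
theorem exists_div_omega0_pow_eq {k : ℕ} {x : Ordinal.{v}} (hx : x < ω ^ (k + 1)) :
    ∃ n : ℕ, x / ω ^ k = n := by
  have h0 : (ω : Ordinal.{v}) ^ k ≠ 0 := pow_ne_zero _ omega0_ne_zero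
  rw [pow_succ] at hx
  exact lt_omega0.1 ((lt_mul_iff_div_lt h0).1 hx)

theorem mod_omega0_pow_lt (k : ℕ) (x : Ordinal.{v}) : x % ω ^ k < ω ^ k :=
  mod_lt x (pow_ne_zero _ omega0_ne_zero)

theorem natSum_lt {k : ℕ} {x y : Ordinal.{v}} (hx : x < ω ^ k) (hy : y < ω ^ k) :
    natSum k x y < ω ^ k := by
  induction k generalizing x y with
  | zero => simp [natSum]
  | succ k ih =>
    obtain ⟨n, hn⟩ := exists_div_omega0_pow_eq hx
    obtain ⟨m, hm⟩ := exists_div_omega0_pow_eq hy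
    rw [natSum, hn, hm, pow_succ, lt_mul_iff]
    exact ⟨_, by exact_mod_cast natCast_lt_omega0 (n + m), _,
      ih (mod_omega0_pow_lt k x) (mod_omega0_pow_lt k y), rfl⟩

theorem natSum_comm {k : ℕ} {x y : Ordinal.{v}} (hx : x < ω ^ k) (hy : y < ω ^ k) :
    natSum k x y = natSum k y x := by
  induction k generalizing x y with
  | zero => rfl
  | succ k ih =>
    obtain ⟨n, hn⟩ := exists_div_omega0_pow_eq hx
    obtain ⟨m, hm⟩ := exists_div_omega0_pow_eq hy
    rw [natSum, natSum, hn, hm, ih (mod_omega0_pow_lt k x) (mod_omega0_pow_lt k y),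
      ← Nat.cast_add, ← Nat.cast_add, add_comm n m]

theorem mul_add_lt_mul_add {a q q' r r' : Ordinal.{v}} (hq : q < q') (hr : r < a) :
    a * q + r < a * q' + r' :=
  calc a * q + r < a * q + a := by gcongr
    _ = a * (q + 1) := by rw [mul_add, mul_one]
    _ ≤ a * q' := by gcongr; exact Order.add_one_le_of_lt hq
    _ ≤ a * q' + r' := le_self_add

theorem natSum_lt_natSum_left {k : ℕ} {x x' y : Ordinal.{v}} (h : x < x') (hx' : x' < ω ^ k)
    (hy : y < ω ^ k) : natSum k x y < natSum k x' y := by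
  induction k generalizing x x' y with
  | zero =>
    rw [pow_zero, Order.lt_one_iff] at hx'
    simp [hx'] at h
  | succ k ih =>
    obtain ⟨n, hn⟩ := exists_div_omega0_pow_eq (h.trans hx')
    obtain ⟨n', hn'⟩ := exists_div_omega0_pow_eq hx'
    obtain ⟨m, hm⟩ := exists_div_omega0_pow_eq hy
    rw [natSum, natSum, hn, hn', hm]
    have hle : n ≤ n' := by
      have := div_le_left h.le (ω ^ k)
      rw [hn, hn'] at this
      exact_mod_cast this
    obtain hlt | rfl := hle.lt_or_eq
    · refine mul_add_lt_mul_add ?_ (natSum_lt (mod_omega0_pow_lt k x) (mod_omega0_pow_lt k y))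
      exact_mod_cast Nat.add_lt_add_right hlt m
    · gcongr
      refine ih ?_ (mod_omega0_pow_lt k x') (mod_omega0_pow_lt k y)
      rw [← div_add_mod x (ω ^ k), ← div_add_mod x' (ω ^ k), hn, hn'] at h
      exact lt_of_add_lt_add_left h

theorem natSum_lt_natSum_right {k : ℕ} {x y y' : Ordinal.{v}} (h : y < y') (hx : x < ω ^ k)
    (hy' : y' < ω ^ k) : natSum k x y < natSum k x y' := by
  rw [natSum_comm hx (h.trans hy'), natSum_comm hx hy']
  exact natSum_lt_natSum_left h hy' hx

theorem natSum_lt_natSum {k : ℕ} {x x' y y' : Ordinal.{v}} (hx : x ≤ x') (hy : y ≤ y')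
    (h : x < x' ∨ y < y') (hx' : x' < ω ^ k) (hy' : y' < ω ^ k) :
    natSum k x y < natSum k x' y' := by
  obtain rfl | hx := hx.eq_or_lt <;> obtain rfl | hy := hy.eq_or_lt
  · simp at h
  · exact natSum_lt_natSum_right hy hx' hy'
  · exact natSum_lt_natSum_left hx hx' hy'
  · exact (natSum_lt_natSum_left hx hx' (hy.trans hy')).trans (natSum_lt_natSum_right hy hx' hy')

/-! ### Chains, length and exact sequences -/

section Chains

variable {R : Type u} [CommRing R] {M N P : Type v} [AddCommGroup M] [Module R M]
  [AddCommGroup N] [Module R N] [AddCommGroup P] [Module R P]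

theorem Iio_lt {α : Ordinal.{v}} (i : Set.Iio α) : i.1 < α := i.2

theorem HasChain.mono {α β : Ordinal.{v}} (h : HasChain R M β) (hαβ : α ≤ β) : HasChain R M α := by
  obtain ⟨f, hf, h0⟩ := h
  exact ⟨fun i => f ⟨i, lt_of_lt_of_le i.2 hαβ⟩, fun i j hij => hf (Subtype.mk_lt_mk.2 hij),
    fun i => h0 _⟩

theorem HasChain.le_len {α : Ordinal.{v}} (h : HasChain R M α) : α ≤ len R M :=
  le_csSup (bddAbove_hasChain R M) h

theorem len_le_iff {α : Ordinal.{v}} : len R M ≤ α ↔ ∀ β, HasChain R M β → β ≤ α := by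
  refine ⟨fun h β hβ => hβ.le_len.trans h, fun h => csSup_le ⟨0, ?_⟩ h⟩
  exact ⟨fun _ => ⊤, fun i => absurd (Iio_lt i) not_lt_zero, fun i => absurd (Iio_lt i) not_lt_zero⟩

theorem HasChain.add_one_of_lt_len {α : Ordinal.{v}} (h : α < len R M) :
    HasChain R M (α + 1) := by
  by_contra hc
  refine h.not_ge (len_le_iff.2 fun β hβ => ?_)
  by_contra! hlt
  exact hc (hβ.mono (Order.add_one_le_of_lt hlt))

theorem HasChain.of_injective {f : N →ₗ[R] M} (hf : Function.Injective f) {α : Ordinal.{v}}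
    (h : HasChain R N α) : HasChain R M α := by
  obtain ⟨F, hF, h0⟩ := h
  exact ⟨fun i => (F i).map f, fun i j hij => Submodule.map_strictMono_of_injective hf (hF hij),
    fun i hi => h0 i (Submodule.map_injective_of_injective hf (hi.trans (Submodule.map_bot f).symm))⟩

theorem HasChain.of_surjective {g : M →ₗ[R] P} (hg : Function.Surjective g) {α : Ordinal.{v}}
    (h : HasChain R P α) : HasChain R M α := by
  obtain ⟨F, hF, h0⟩ := h
  refine ⟨fun i => (F i).comap g, fun i j hij => Submodule.comap_strictMono_of_surjective hg (hF hij),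
    fun i hi => h0 i ?_⟩
  rw [← Submodule.map_comap_eq_of_surjective hg (F i), show (F i).comap g = ⊥ from hi,
    Submodule.map_bot]

theorem len_le_of_injective {f : N →ₗ[R] M} (hf : Function.Injective f) : len R N ≤ len R M :=
  len_le_iff.2 fun _ h => (h.of_injective hf).le_len

theorem len_le_of_surjective {g : M →ₗ[R] P} (hg : Function.Surjective g) :
    len R P ≤ len R M :=
  len_le_iff.2 fun _ h => (h.of_surjective hg).le_len

/-- Preimages of the chain in `P` lie strictly above the range of `f`, images of the chain in `N`
below it. Under inverse inclusion the quotient comes first, hence the order of the summands. -/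
theorem HasChain.add {f : N →ₗ[R] M} {g : M →ₗ[R] P} (hf : Function.Injective f)
    (hg : Function.Surjective g) (hfg : Function.Exact f g) {α β : Ordinal.{v}}
    (hP : HasChain R P α) (hN : HasChain R N β) : HasChain R M (α + β) := by
  obtain ⟨F, hF, hF0⟩ := hP
  obtain ⟨G, hG, hG0⟩ := hN
  have key (i : Set.Iio α) : LinearMap.range f < (F i).comap g := by
    refine lt_of_le_of_ne ?_ fun h => hF0 i ?_
    · rintro _ ⟨x, rfl⟩
      simp [hfg.apply_apply_eq_zero x]
    · rw [← Submodule.map_comap_eq_of_surjective hg (F i), ← h, ← hfg.linearMap_ker_eq]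
      exact LinearMap.le_ker_iff_map.1 le_rfl
  have sub {i : Ordinal.{v}} (hi : i < α + β) (h : ¬ i < α) : i - α < β :=
    Ordinal.sub_lt_of_le (not_lt.1 h) |>.2 hi
  refine ⟨fun i => if h : i.1 < α then (F ⟨i, h⟩).comap g else (G ⟨i - α, sub (Iio_lt i) h⟩).map f,
    fun i j hij => ?_, fun i => ?_⟩
  · have hij' : i.1 < j.1 := hij
    by_cases hj : j.1 < α
    · simp only [hj, hij'.trans hj, dif_pos]
      exact Submodule.comap_strictMono_of_surjective hg (hF hij)
    · by_cases hi : i.1 < α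
      · simp only [hi, hj, dif_pos, dif_neg, not_false_eq_true]
        exact LinearMap.map_le_range.trans_lt (key _)
      · simp only [hi, hj, dif_neg, not_false_eq_true]
        refine Submodule.map_strictMono_of_injective hf (hG ?_)
        refine Subtype.mk_lt_mk.2 ?_
        rw [← Ordinal.add_sub_cancel_of_le (not_lt.1 hi),
          ← Ordinal.add_sub_cancel_of_le (not_lt.1 hj)] at hij'
        exact lt_of_add_lt_add_left hij'
  · by_cases hi : i.1 < α
    · simp only [hi, dif_pos]
      exact (bot_le.trans_lt (key _)).ne'
    · simp only [hi, dif_neg, not_false_eq_true]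
      exact fun h => hG0 _ (Submodule.map_injective_of_injective hf (h.trans (Submodule.map_bot f).symm))

theorem HasChain.one [Nontrivial M] : HasChain R M 1 := by
  refine ⟨fun _ => ⊤, fun i j hij => ?_, fun _ => top_ne_bot⟩
  have hi := Order.lt_one_iff.1 (Iio_lt i)
  have hj := Order.lt_one_iff.1 (Iio_lt j)
  have hij' : i.1 < j.1 := hij
  simp [hi, hj] at hij'

theorem len_eq_zero [Subsingleton M] : len R M = 0 := by
  refine nonpos_iff_eq_zero.1 (len_le_iff.2 fun β ⟨F, _, h0⟩ => ?_)
  by_contra! h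
  exact h0 ⟨0, h⟩ (Subsingleton.elim _ _)

theorem len_pos [Nontrivial M] : 0 < len R M :=
  Order.one_le_iff_pos.1 HasChain.one.le_len

/-- In a totally ordered set of submodules, ranks are realised by chains. -/
theorem hasChain_of_rank {S : Set (Submodule R M)} [WellFoundedGT S] (hS : IsChain (· ≤ ·) S)
    {α : Ordinal.{v}}
    (h : ∀ γ < α, ∃ x : S, IsWellFounded.rank (α := S) (· > ·) x = γ ∧ x.1 ≠ ⊥) :
    HasChain R M α := by
  choose x hx hx0 using h
  refine ⟨fun γ => x γ (Iio_lt γ), fun γ δ hγδ => ?_, fun γ => hx0 _ _⟩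
  have hlt : IsWellFounded.rank (α := S) (· > ·) (x γ (Iio_lt γ)) <
      IsWellFounded.rank (α := S) (· > ·) (x δ (Iio_lt δ)) := by rwa [hx, hx]
  have hnle : ¬ (x γ (Iio_lt γ)).1 ≤ (x δ (Iio_lt δ)).1 := fun hle => by
    obtain he | hl := hle.eq_or_lt
    · exact hlt.ne (congrArg _ (Subtype.ext he))
    · exact hlt.not_gt (WellFoundedGT.rank_strictAnti (α := S) hl)
  exact lt_of_le_not_ge ((hS.total (x γ (Iio_lt γ)).2 (x δ (Iio_lt δ)).2).resolve_left hnle) hnle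

theorem rank_le_len {S : Set (Submodule R M)} [WellFoundedGT S] (hS : IsChain (· ≤ ·) S) (x : S) :
    IsWellFounded.rank (α := S) (· > ·) x ≤ len R M := by
  refine (hasChain_of_rank hS fun γ hγ => ?_).le_len
  obtain ⟨y, hy⟩ := IsWellFounded.mem_range_rank_of_le hγ.le
  refine ⟨y, hy, fun h0 => hγ.not_ge ?_⟩
  rw [← hy]
  exact (WellFoundedGT.rank_strictAnti (α := S)).antitone (show y.1 ≤ x.1 from h0 ▸ bot_le)

/-- A nonzero `x` can itself be appended to the chain of its predecessors; this extra term makes the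
bound strict. -/
theorem rank_lt_len {S : Set (Submodule R M)} [WellFoundedGT S] (hS : IsChain (· ≤ ·) S) (x : S)
    (hx : x.1 ≠ ⊥) : IsWellFounded.rank (α := S) (· > ·) x < len R M := by
  refine Order.add_one_le_iff.1 (hasChain_of_rank hS fun γ hγ => ?_).le_len
  obtain hγ | rfl := (Order.lt_add_one_iff.1 hγ).lt_or_eq
  · obtain ⟨y, hy⟩ := IsWellFounded.mem_range_rank_of_le hγ.le
    refine ⟨y, hy, fun h0 => hγ.not_ge ?_⟩
    rw [← hy]
    exact (WellFoundedGT.rank_strictAnti (α := S)).antitone (show y.1 ≤ x.1 from h0 ▸ bot_le)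
  · exact ⟨x, rfl, hx⟩

theorem eq_of_comap_eq_of_map_eq {f : N →ₗ[R] M} {g : M →ₗ[R] P} (hfg : Function.Exact f g)
    {A B : Submodule R M} (hBA : B ≤ A) (h₁ : A.comap f = B.comap f) (h₂ : A.map g = B.map g) :
    A = B := by
  refine le_antisymm (fun x hx => ?_) hBA
  obtain ⟨y, hy, hyx⟩ : g x ∈ B.map g := h₂ ▸ Submodule.mem_map_of_mem hx
  obtain ⟨n, hn⟩ := (hfg (x - y)).1 (by rw [map_sub, ← hyx]; exact sub_self _)
  have hnA : n ∈ A.comap f := by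
    rw [Submodule.mem_comap, hn]
    exact A.sub_mem hx (hBA hy)
  rw [h₁, Submodule.mem_comap, hn] at hnA
  simpa using B.add_mem hnA hy

theorem le_apply_of_strictMono_Iio {β : Ordinal.{v}} {T : Set.Iio β → Ordinal.{v}}
    (hT : StrictMono T) (i : Set.Iio β) : i.1 ≤ T i := by
  induction i using WellFoundedLT.induction with
  | ind i ih =>
    refine le_of_forall_lt fun c hc => ?_
    exact (ih ⟨c, hc.trans i.2⟩ hc).trans_lt (hT hc)

/-- The modules of length less than `ω ^ d` are closed under extensions. -/
theorem len_lt_of_exact [IsNoetherian R N] [IsNoetherian R P] {f : N →ₗ[R] M} {g : M →ₗ[R] P}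
    (hfg : Function.Exact f g) {d : ℕ} (hN : len R N < ω ^ d) (hP : len R P < ω ^ d) :
    len R M < ω ^ d := by
  refine lt_of_le_of_lt (len_le_iff.2 fun β ⟨F, hF, h0⟩ => ?_) (natSum_lt hN hP)
  have hSN : IsChain (· ≤ ·) (Set.range fun i => (F i).comap f) := by
    rintro _ ⟨i, rfl⟩ _ ⟨j, rfl⟩ -
    exact (le_total i j).symm.imp 
      (fun h => Submodule.comap_mono (hF.antitone h)) (fun h => Submodule.comap_mono (hF.antitone h))
  have hSP : IsChain (· ≤ ·) (Set.range fun i => (F i).map g) := by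
    rintro _ ⟨i, rfl⟩ _ ⟨j, rfl⟩ -
    exact (le_total i j).symm.imp 
      (fun h => Submodule.map_mono (hF.antitone h)) (fun h => Submodule.map_mono (hF.antitone h))
  let x (i : Set.Iio β) : Set.range fun i => (F i).comap f := ⟨_, i, rfl⟩
  let y (i : Set.Iio β) : Set.range fun i => (F i).map g := ⟨_, i, rfl⟩
  -- Of two nested distinct submodules, at least one trace (preimage under `f`, image under `g`)
  -- differs, so this natural sum of ranks increases strictly.
  let T (i : Set.Iio β) : Ordinal.{v} := natSum d (IsWellFounded.rank (· > ·) (x i))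
    (IsWellFounded.rank (· > ·) (y i))
  have hT : StrictMono T := fun i j hij => by
    have hle := (hF hij).le
    have hx : x j ≤ x i := Submodule.comap_mono (f := f) hle
    have hy : y j ≤ y i := Submodule.map_mono (f := g) hle
    refine natSum_lt_natSum (WellFoundedGT.rank_strictAnti.antitone hx)
      (WellFoundedGT.rank_strictAnti.antitone hy) ?_ ((rank_le_len hSN _).trans_lt hN)
      ((rank_le_len hSP _).trans_lt hP)
    by_contra! hc
    have hx' : x i = x j := by
      by_contra hne
      exact hc.1.not_gt (WellFoundedGT.rank_strictAnti (lt_of_le_of_ne hx (Ne.symm hne)))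
    have hy' : y i = y j := by
      by_contra hne
      exact hc.2.not_gt (WellFoundedGT.rank_strictAnti (lt_of_le_of_ne hy (Ne.symm hne)))
    exact (hF hij).ne' (eq_of_comap_eq_of_map_eq hfg hle (congrArg Subtype.val hx')
      (congrArg Subtype.val hy'))
  -- A nonzero `F i` has a nonzero trace on one side, and there the rank is strictly below the
  -- length.
  have hlt (i : Set.Iio β) : T i < natSum d (len R N) (len R P) := by
    refine natSum_lt_natSum (rank_le_len hSN _) (rank_le_len hSP _) ?_ hN hP
    by_cases hx : (F i).comap f = ⊥
    · refine Or.inr (rank_lt_len hSP _ fun hy => h0 i ?_)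
      have hb : (⊥ : Submodule R M).comap f = ⊥ :=
        le_bot_iff.1 ((Submodule.comap_mono bot_le).trans hx.le)
      exact eq_of_comap_eq_of_map_eq hfg bot_le (hx.trans hb.symm)
        (hy.trans (Submodule.map_bot g).symm)
    · exact Or.inl (rank_lt_len hSN _ hx)
  by_contra! hc
  exact ((le_apply_of_strictMono_Iio hT ⟨_, hc⟩).trans_lt (hlt _)).false

end Chains

/-! ### Lengths of compressible modules -/

section Compressible

variable {R : Type u} [CommRing R] {M : Type v} [AddCommGroup M] [Module R M]

/-- The last member of a chain of successor type is a lower bound for the others. -/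
theorem HasChain.exists_lt {α : Ordinal.{v}} (h : HasChain R M (α + 1)) :
    ∃ N : Submodule R M, N ≠ ⊥ ∧
      ∃ F : Set.Iio α → Submodule R M, StrictAnti F ∧ ∀ i, N < F i := by
  obtain ⟨F, hF, h0⟩ := h
  refine ⟨F ⟨α, lt_add_one α⟩, h0 _,
    fun i => F ⟨i, (Iio_lt i).trans (lt_add_one α)⟩, fun i j hij => hF ?_, fun i => hF ?_⟩
  · exact Subtype.mk_lt_mk.2 hij
  · exact Subtype.mk_lt_mk.2 (Iio_lt i)

theorem hasChain_quotient {α : Ordinal.{v}} {N : Submodule R M} {F : Set.Iio α → Submodule R M}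
    (hF : StrictAnti F) (hN : ∀ i, N < F i) : HasChain R (M ⧸ N) α := by
  have key (i : Set.Iio α) : ((F i).map N.mkQ).comap N.mkQ = F i := by
    rw [Submodule.comap_map_mkQ, sup_eq_right.2 (hN i).le]
  refine ⟨fun i => (F i).map N.mkQ, fun i j hij => ?_, fun i hi => (hN i).ne ?_⟩
  · refine lt_of_le_of_ne (Submodule.map_mono (hF hij).le) fun h => (hF hij).ne ?_
    rw [← key i, ← key j]
    exact congrArg _ h
  · rw [← key i, show (F i).map N.mkQ = ⊥ from hi, ← LinearMap.ker, Submodule.ker_mkQ]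

/-- The length of a compressible module is additively indecomposable. -/
theorem IsCompressible.exists_len_eq_opow [Nontrivial M] (h : IsCompressible R M) :
    ∃ e : Ordinal.{v}, len R M = ω ^ e := by
  have hp : IsPrincipal (· + ·) (len R M) := by
    refine isPrincipal_add_iff_add_left_eq_self.2 fun α hα => ?_
    refine le_antisymm ?_ le_add_self
    -- `M ⧸ N` has a chain of type `α`, while `N` contains a copy of `M` and so is at least as long.
    obtain ⟨N, hN, F, hF, hNF⟩ := (HasChain.add_one_of_lt_len hα).exists_lt
    obtain ⟨a, ha⟩ := h N hN
    by_contra! hlt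
    have hsub : len R M - α < len R N :=
      ((Ordinal.sub_lt_of_le hα.le).2 hlt).trans_le (len_le_of_injective ha)
    -- The chain taken in `N` has type `(len R M - α) + 1`, so the combined type is `len R M + 1`.
    have hc := (HasChain.add N.injective_subtype N.mkQ_surjective (LinearMap.exact_subtype_mkQ N)
      (hasChain_quotient hF hNF) (HasChain.add_one_of_lt_len hsub)).le_len
    rw [← add_assoc, Ordinal.add_sub_cancel_of_le hα.le] at hc
    exact (lt_add_one _).not_ge hc
  obtain h0 | ⟨e, he⟩ := isPrincipal_add_iff_zero_or_omega0_opow.1 hp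
  · exact absurd h0 len_pos.ne'
  · exact ⟨e, he.symm⟩

/-- The length of a compressible module is attained, if it is a finite power of `ω`. -/
theorem IsCompressible.hasChain_len (h : IsCompressible R M) {e : ℕ} (he : len R M = ω ^ e) :
    HasChain R M (ω ^ e) := by
  have : Nontrivial M := by
    rw [← not_subsingleton_iff_nontrivial]
    intro
    exact (pow_pos omega0_pos e).ne (len_eq_zero.symm.trans he)
  cases e with
  | zero => simpa using HasChain.one
  | succ k =>
    have hlt : ω ^ k < len R M := he ▸ pow_lt_pow_right₀ one_lt_omega0 k.lt_succ_self
    obtain ⟨N, hN, F, hF, hNF⟩ := (HasChain.add_one_of_lt_len hlt).exists_lt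
    obtain ⟨a, ha⟩ := h N hN
    -- Since `A` maps `M` into `N`, below every `F i`, the chain `F` carried by `A ^ n` fits between
    -- the ranges of `A ^ n` and `A ^ (n + 1)`. Stacking these `ω` blocks gives type `ω ^ k * ω`;
    -- quotient and remainder by `ω ^ k` give the block and the place in it.
    let A : Module.End R M := N.subtype ∘ₗ a
    have hA (n : ℕ) : Function.Injective ⇑(A ^ n) := by
      rw [Module.End.coe_pow]
      exact (N.injective_subtype.comp ha).iterate n
    choose q hq using fun i : Set.Iio (ω ^ (k + 1)) => exists_div_omega0_pow_eq (Iio_lt i)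
    have hlast (n : ℕ) (i : Set.Iio (ω ^ k)) :
        LinearMap.range (A ^ (n + 1)) < (F i).map (A ^ n) := by
      refine lt_of_le_of_lt ?_ (Submodule.map_strictMono_of_injective (hA n) (hNF i))
      rintro _ ⟨x, rfl⟩
      rw [pow_succ]
      exact ⟨A x, (a x).2, rfl⟩
    have hrange {n m : ℕ} (hnm : n ≤ m) : LinearMap.range (A ^ m) ≤ LinearMap.range (A ^ n) := by
      obtain ⟨l, rfl⟩ := Nat.exists_eq_add_of_le hnm
      rw [pow_add]
      exact LinearMap.range_comp_le_range _ _
    let r (i : Set.Iio ((ω : Ordinal.{v}) ^ (k + 1))) : Set.Iio ((ω : Ordinal.{v}) ^ k) :=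
      ⟨i % ω ^ k, mod_omega0_pow_lt k i⟩
    refine ⟨fun i => (F (r i)).map (A ^ q i), fun i j hij => ?_,
      fun i => (bot_le.trans_lt (hlast _ _)).ne'⟩
    have hij' : i.1 < j.1 := hij
    have hle : q i ≤ q j := by
      have := div_le_left hij'.le (ω ^ k)
      rw [hq, hq] at this
      exact_mod_cast this
    obtain hlt | heq := hle.lt_or_eq
    · exact (LinearMap.map_le_range.trans (hrange hlt)).trans_lt (hlast _ _)
    · simp only [heq]
      refine Submodule.map_strictMono_of_injective (hA _) (hF (Subtype.mk_lt_mk.2 ?_))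
      rw [← div_add_mod i.1 (ω ^ k), ← div_add_mod j.1 (ω ^ k), hq, hq, heq] at hij'
      exact lt_of_add_lt_add_left hij'

theorem IsCompressible.of_injective {N : Type v} [AddCommGroup N] [Module R N]
    (hN : IsCompressible R N) {f : M →ₗ[R] N} (hf : Function.Injective f) : IsCompressible R M := by
  intro K hK
  obtain ⟨g, hg⟩ := hN (K.map f)
    fun h => hK (Submodule.map_injective_of_injective hf (h.trans (Submodule.map_bot f).symm))
  let e := Submodule.equivMapOfInjective f hf K
  exact ⟨e.symm.toLinearMap ∘ₗ g ∘ₗ f, e.symm.injective.comp (hg.comp hf)⟩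

end Compressible

/-! ### Quotients by primes and prime filtrations -/

section Prime

variable {R : Type u} [CommRing R] {Q : Type v} [AddCommGroup Q] [Module R Q]

theorem smul_eq_zero_of_equiv {p : Ideal R} (e : Q ≃ₗ[R] R ⧸ p) {r : R} (hr : r ∈ p) (x : Q) :
    r • x = 0 := by
  apply e.injective
  obtain ⟨s, hs⟩ := Ideal.Quotient.mk_surjective (e x)
  rw [map_smul, map_zero, ← hs, ← Ideal.Quotient.mk_eq_mk, ← Submodule.Quotient.mk_smul,
    Submodule.Quotient.mk_eq_zero]
  exact p.mul_mem_right s hr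

theorem mem_of_smul_eq_zero {p : Ideal R} [p.IsPrime] (e : Q ≃ₗ[R] R ⧸ p) {r : R} {x : Q}
    (hx : x ≠ 0) (h : r • x = 0) : r ∈ p := by
  obtain ⟨s, hs⟩ := Ideal.Quotient.mk_surjective (e x)
  have hs0 : s ∉ p := fun hmem => hx (e.injective (by
    rw [map_zero, ← hs, Ideal.Quotient.eq_zero_iff_mem.2 hmem]))
  have h' := congrArg e h
  rw [map_smul, map_zero, ← hs, ← Ideal.Quotient.mk_eq_mk, ← Submodule.Quotient.mk_smul,
    Submodule.Quotient.mk_eq_zero] at h'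
  exact (Ideal.IsPrime.mem_or_mem ‹_› h').resolve_right hs0

/-- A representative `r` of a nonzero `y ∈ N` works: `Q` is cyclic, so every `r • x` is a multiple
of `y`. -/
theorem exists_smul_mem {p : Ideal R} (e : Q ≃ₗ[R] R ⧸ p) {N : Submodule R Q}
    (hN : N ≠ ⊥) : ∃ r ∉ p, ∀ x : Q, r • x ∈ N := by
  obtain ⟨y, hy, hy0⟩ := N.exists_mem_ne_zero_of_ne_bot hN
  obtain ⟨r, hr⟩ := Ideal.Quotient.mk_surjective (e y)
  refine ⟨r, fun hmem => hy0 (e.injective (by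
    rw [map_zero, ← hr, Ideal.Quotient.eq_zero_iff_mem.2 hmem])), fun x => ?_⟩
  obtain ⟨s, hs⟩ := Ideal.Quotient.mk_surjective (e x)
  have : r • x = s • y := by
    apply e.injective
    rw [map_smul, map_smul, ← hs, ← hr, ← Ideal.Quotient.mk_eq_mk, ← Ideal.Quotient.mk_eq_mk,
      ← Submodule.Quotient.mk_smul, ← Submodule.Quotient.mk_smul, _root_.smul_eq_mul,
      _root_.smul_eq_mul, mul_comm]
  rw [this]
  exact N.smul_mem s hy

theorem isCompressible_of_equiv {p : Ideal R} [p.IsPrime] (e : Q ≃ₗ[R] R ⧸ p) :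
    IsCompressible R Q := by
  intro N hN
  obtain ⟨r, hr, hrN⟩ := exists_smul_mem e hN
  refine ⟨(LinearMap.lsmul R Q r).codRestrict N hrN, ?_⟩
  refine (injective_iff_map_eq_zero _).2 fun x hx => ?_
  by_contra hx0
  exact hr (mem_of_smul_eq_zero e hx0 (congrArg Subtype.val hx))

/-- Every finitely generated module of smaller length than `R ⧸ p` is killed outside `p`. -/
theorem exists_notMem_smul_eq_zero [IsNoetherianRing R] {L : Type v} [AddCommGroup L] [Module R L]
    {p : Ideal R} [p.IsPrime] (e : L ≃ₗ[R] R ⧸ p) [hfin : Module.Finite R Q]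
    (hQ : len R Q < len R L) : ∃ s ∉ p, ∀ x : Q, s • x = 0 := by
  induction hfin using IsNoetherianRing.induction_on_isQuotientEquivQuotientPrime R with
  | subsingleton N =>
    exact ⟨1, (Ideal.ne_top_iff_one p).1 ‹p.IsPrime›.ne_top, fun x => Subsingleton.elim _ _⟩
  | quotient N q f =>
    -- Otherwise `R ⧸ q` would surject onto `R ⧸ p` and be at least as long.
    have hqp : ¬ q.1 ≤ p := fun hle => hQ.not_ge
      (len_le_of_surjective (g := e.symm.toLinearMap ∘ₗ Submodule.factor hle ∘ₗ f.toLinearMap)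
        (e.symm.surjective.comp ((Submodule.factor_surjective hle).comp f.surjective)))
    obtain ⟨s, hsq, hsp⟩ := SetLike.not_le_iff_exists.1 hqp
    exact ⟨s, hsp, smul_eq_zero_of_equiv f hsq⟩
  | exact N₁ N₂ N₃ f g hf hg hfg h₁ h₃ =>
    obtain ⟨s, hs, hs0⟩ := h₁ ((len_le_of_injective hf).trans_lt hQ)
    obtain ⟨t, ht, ht0⟩ := h₃ ((len_le_of_surjective hg).trans_lt hQ)
    refine ⟨s * t, fun h => (Ideal.IsPrime.mem_or_mem ‹_› h).elim hs ht, fun x => ?_⟩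
    obtain ⟨y, hy⟩ := (hfg (t • x)).1 (by rw [map_smul, ht0])
    rw [mul_smul, ← hy, ← map_smul, hs0, map_zero]

/-- If all primes strictly above `p` have small length, then so has every finitely generated
torsion module over `R ⧸ p`. -/
theorem len_lt_of_smul_eq_zero [IsNoetherianRing R] {p : PrimeSpectrum R} {d : ℕ}
    (ih : ∀ q : PrimeSpectrum R, p < q → ∀ (L : Type v) [AddCommGroup L] [Module R L],
      (L ≃ₗ[R] R ⧸ q.1) → len R L < ω ^ d)
    [hfin : Module.Finite R Q] (hp : ∀ r ∈ p.1, ∀ x : Q, r • x = 0) {s : R} (hs : s ∉ p.1)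
    (hs0 : ∀ x : Q, s • x = 0) : len R Q < ω ^ d := by
  induction hfin using IsNoetherianRing.induction_on_isQuotientEquivQuotientPrime R with
  | subsingleton N => exact len_eq_zero.trans_lt (pow_pos omega0_pos d)
  | quotient N q f =>
    have := f.toEquiv.nontrivial
    obtain ⟨x, hx⟩ := exists_ne (0 : N)
    have hpq : p.1 ≤ q.1 := fun r hr => mem_of_smul_eq_zero f hx (hp r hr x)
    have hsq : s ∈ q.1 := mem_of_smul_eq_zero f hx (hs0 x)
    exact ih q (lt_of_le_of_ne hpq fun h => hs (h ▸ hsq)) N f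
  | exact N₁ N₂ N₃ f g hf hg hfg h₁ h₃ =>
    refine len_lt_of_exact hfg (h₁ (fun r hr x => hf ?_) fun x => hf ?_)
      (h₃ (fun r hr x => ?_) fun x => ?_)
    · rw [map_smul, map_zero, hp r hr]
    · rw [map_smul, map_zero, hs0]
    · obtain ⟨y, rfl⟩ := hg x
      rw [← map_smul, hp r hr, map_zero]
    · obtain ⟨y, rfl⟩ := hg x
      rw [← map_smul, hs0, map_zero]

/-- A longer chain would yield a chain of type `ω ^ n` in some `L ⧸ N` with `N ≠ ⊥`. That quotient
is torsion over `R ⧸ p`, and primes strictly above `p` have smaller coheight, so by induction its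
length is below `ω ^ n`. -/
theorem len_le_pow_coheight [IsNoetherianRing R] (n : ℕ) (p : PrimeSpectrum R)
    (hn : Order.coheight p = n) (L : Type v) [AddCommGroup L] [Module R L]
    (e : L ≃ₗ[R] R ⧸ p.1) : len R L ≤ ω ^ n := by
  induction n using Nat.strong_induction_on generalizing p L with
  | _ n ih =>
    by_contra! hlt
    obtain ⟨N, hN, F, hF, hNF⟩ := (HasChain.add_one_of_lt_len hlt).exists_lt
    have : Module.Finite R L := Module.Finite.equiv e.symm
    obtain ⟨s, hs, hsN⟩ := exists_smul_mem e hN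
    refine (hasChain_quotient hF hNF).le_len.not_gt
      (len_lt_of_smul_eq_zero (fun q hpq L _ _ f => ?_) (fun r hr x => ?_) hs fun x => ?_)
    · have hq : Order.coheight q < n :=
        hn ▸ Order.coheight_strictAnti hpq (lt_of_le_of_lt (Order.coheight_anti hpq.le)
          (hn ▸ WithTop.coe_lt_top n))
      lift Order.coheight q to ℕ using hq.ne_top with m hm
      have hmn : m < n := by exact_mod_cast hq
      exact (ih m hmn q hm.symm L f).trans_lt (pow_lt_pow_right₀ one_lt_omega0 hmn)
    · obtain ⟨y, rfl⟩ := N.mkQ_surjective x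
      rw [← map_smul, smul_eq_zero_of_equiv e hr, map_zero]
    · obtain ⟨y, rfl⟩ := N.mkQ_surjective x
      rw [← map_smul]
      exact (Submodule.Quotient.mk_eq_zero N).2 (hsN y)

theorem exists_submodule_equiv_quotient_prime [IsNoetherianRing R] [Nontrivial Q] :
    ∃ (p : Ideal R) (_ : p.IsPrime) (N : Submodule R Q), Nonempty (N ≃ₗ[R] R ⧸ p) := by
  obtain ⟨p, hp⟩ := associatedPrimes.nonempty R Q
  obtain ⟨hprime, f, hf⟩ := (isAssociatedPrime_iff_exists_injective_linearMap _ _).1 hp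
  exact ⟨p, hprime, LinearMap.range f, ⟨(LinearEquiv.ofInjective f hf).symm⟩⟩

/-! ### Finite Krull dimension and the two implications -/

variable [IsNoetherianRing R] [FiniteRingKrullDim R]

/-- Compressibility gives an ordinal exponent; the bound by the finite coheight forces it to be a
natural number. -/
theorem exists_len_eq_pow_of_equiv {p : Ideal R} [hp : p.IsPrime] (e : Q ≃ₗ[R] R ⧸ p) :
    ∃ d : ℕ, len R Q = ω ^ d := by
  have := e.toEquiv.nontrivial
  obtain ⟨n, hn⟩ := ENat.ne_top_iff_exists.1
    (Order.coheight_lt_top (⟨p, hp⟩ : PrimeSpectrum R)).ne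
  have hle := len_le_pow_coheight n ⟨p, hp⟩ hn.symm Q e
  obtain ⟨d, hd⟩ := (isCompressible_of_equiv e).exists_len_eq_opow
  rw [hd, ← opow_natCast, opow_le_opow_iff_right one_lt_omega0] at hle
  obtain ⟨d, rfl⟩ := lt_omega0.1 (hle.trans_lt (natCast_lt_omega0 n))
  exact ⟨d, by rw [hd, opow_natCast]⟩

/-- A finitely generated module has a chain of type `ω ^ d` as soon as its length is at least
`ω ^ d`. -/
theorem len_lt_of_not_hasChain [hfin : Module.Finite R Q] {d : ℕ} (h : ¬ HasChain R Q (ω ^ d)) :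
    len R Q < ω ^ d := by
  induction hfin using IsNoetherianRing.induction_on_isQuotientEquivQuotientPrime R with
  | subsingleton N => exact len_eq_zero.trans_lt (pow_pos omega0_pos d)
  | quotient N q f =>
    obtain ⟨e, he⟩ := exists_len_eq_pow_of_equiv f
    by_contra! hle
    exact h (((isCompressible_of_equiv f).hasChain_len he).mono (he ▸ hle))
  | exact N₁ N₂ N₃ f g hf hg hfg h₁ h₃ =>
    exact len_lt_of_exact hfg (h₁ fun hc => h (hc.of_injective hf))
      (h₃ fun hc => h (hc.of_surjective hg))

variable [Nontrivial Q]

theorem IsCompressible.isUnivalent (h : IsCompressible R Q) : IsUnivalent R Q := by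
  obtain ⟨p, hp, N, ⟨e⟩⟩ := exists_submodule_equiv_quotient_prime (R := R) (Q := Q)
  obtain ⟨d, hd⟩ := exists_len_eq_pow_of_equiv e
  have : Nontrivial N := e.toEquiv.nontrivial
  obtain ⟨f, hf⟩ := h N (Submodule.nontrivial_iff_ne_bot.1 this)
  refine ⟨d, ?_⟩
  rw [opow_natCast, ← hd]
  exact (len_le_of_injective hf).antisymm (len_le_of_injective N.injective_subtype)

theorem IsUnivalent.isCompressible [Module.Finite R Q] (h : IsUnivalent R Q) : IsCompressible R Q := by
  obtain ⟨d, hd⟩ := h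
  rw [opow_natCast] at hd
  have hquot (N : Submodule R Q) (hN : N ≠ ⊥) : len R (Q ⧸ N) < ω ^ d := by
    refine len_lt_of_not_hasChain fun hc => ?_
    have : Nontrivial N := Submodule.nontrivial_iff_ne_bot.2 hN
    -- A chain of type `ω ^ d` in `Q ⧸ N`, followed by `N` itself, has type `ω ^ d + 1`.
    have := (hc.add N.injective_subtype N.mkQ_surjective (LinearMap.exact_subtype_mkQ N) .one).le_len
    exact (lt_add_one _).not_ge (this.trans hd.le)
  have hsub (N : Submodule R Q) (hN : N ≠ ⊥) : ω ^ d ≤ len R N := by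
    by_contra! hlt
    exact (len_lt_of_exact (LinearMap.exact_subtype_mkQ N) hlt (hquot N hN)).ne hd
  obtain ⟨p, hp, N, ⟨e⟩⟩ := exists_submodule_equiv_quotient_prime (R := R) (Q := Q)
  have hN : N ≠ ⊥ := Submodule.nontrivial_iff_ne_bot.1 e.toEquiv.nontrivial
  obtain ⟨s, hs, hs0⟩ := exists_notMem_smul_eq_zero e ((hquot N hN).trans_le (hsub N hN))
  have hsN (x : Q) : s • x ∈ N := by
    rw [← Submodule.Quotient.mk_eq_zero, Submodule.Quotient.mk_smul, hs0]
  refine (isCompressible_of_equiv e).of_injective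
    (f := (LinearMap.lsmul R Q s).codRestrict N hsN) ?_
  rw [← LinearMap.ker_eq_bot]
  by_contra hK
  -- The kernel of multiplication by `s` meets `N ≅ R ⧸ p` trivially as `s ∉ p`, so it embeds in `Q
  -- ⧸ N`, which is too short to contain a nonzero submodule of `Q`.
  refine ((hsub _ hK).trans (len_le_of_injective
    (f := N.mkQ ∘ₗ Submodule.subtype _) ?_)).not_gt (hquot N hN)
  refine (injective_iff_map_eq_zero _).2 fun x hx => ?_
  by_contra hx0
  have hxN : x.1 ∈ N := (Submodule.Quotient.mk_eq_zero N).1 hx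
  have hsx : s • x.1 = 0 := congrArg Subtype.val (LinearMap.mem_ker.1 x.2)
  refine hs (mem_of_smul_eq_zero e (x := ⟨x.1, hxN⟩) (fun h => hx0 ?_) (Subtype.ext hsx))
  exact Subtype.ext (congrArg (fun y : N => (y : Q)) h)

end Prime
end OrdinalLength

theorem corollaryC {R : Type*} [CommRing R] [IsNoetherianRing R] [FiniteRingKrullDim R]
    {M : Type*} [AddCommGroup M] [Module R M] [Module.Finite R M] [Nontrivial M] :
    OrdinalLength.IsCompressible R M ↔ OrdinalLength.IsUnivalent R M :=
  ⟨fun h => h.isUnivalent, fun h => h.isCompressible⟩
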